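/- For every integer $d\ge 5$ there is a finite set $A\subset\mathbb Z^d$ which tiles $\mathbb Z^d$ by translation but is not spectral in $\mathbb Z^d$, and such that the finite union of unit cubes $E=A+[0,1)^d\subset\mathbb R^d$, as well as its interior (a bounded open set), tiles $\mathbb R^d$ by translation but is not spectral in $\mathbb R^d$. In particular, each of the groups $\mathbb Z^d$ and $\mathbb R^d$, $d\ge 5$, contains a set that tiles the group by translation but is not spectral. Here $G=\mathbb Z^d$ carries the discrete topology and counting measure, and $G=\mathbb R^d$ the usual topology and Lebesgue measure. A set $\Omega\subseteq G$ tiles $G$ by translation if there is a set $T\subseteq G$ with $\sum_{t\in T}\chi_\Omega(x-t)=1$ for almost every $x\in G$. A measurable set $\Omega$ of finite measure is spectral if there is a set $\Lambda$ of continuous characters of $G$ (continuous homomorphisms from $G$ to the unit circle) which forms an orthogonal basis of the Hilbert space $L^2(\Omega)$. -/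

import Mathlib

open MeasureTheory

noncomputable section

/-- `T` is a tiling complement of `Ω` in the group `G` with Haar measure `μ`:
`∑_{t ∈ T} χ_Ω (x - t) = 1` for almost every `x`. The sum is taken in `[0, ∞]`. -/
def IsTilingComplement {G : Type*} [AddCommGroup G] [MeasurableSpace G]
    (μ : Measure G) (Ω T : Set G) : Prop :=
  ∀ᵐ x ∂μ, ∑' t : T, Ω.indicator (fun _ => (1 : ENNReal)) (x - (t : G)) = 1

/-- `Ω` tiles `G` by translation. -/
def TilesByTranslation {G : Type*} [AddCommGroup G] [MeasurableSpace G]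
    (μ : Measure G) (Ω : Set G) : Prop :=
  ∃ T : Set G, IsTilingComplement μ Ω T

/-- The set `Λ` of characters of `G` is a spectrum of the set `Ω` (of finite measure): its elements
are continuous characters, they are pairwise orthogonal in `L²(Ω)`, and their classes in `L²(Ω)`
have dense linear span; that is, `Λ` is an orthogonal basis of the Hilbert space `L²(Ω)`. -/
structure IsSpectrum {G : Type*} [AddCommGroup G] [TopologicalSpace G] [MeasurableSpace G]
    (μ : Measure G) (Ω : Set G) (Λ : Set (AddChar G Circle)) : Prop where
  continuous : ∀ χ ∈ Λ, Continuous χ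
  orthogonal : ∀ χ ∈ Λ, ∀ ψ ∈ Λ, χ ≠ ψ →
    ∫ x in Ω, (χ x : ℂ) * (starRingEnd ℂ) (ψ x : ℂ) ∂μ = 0
  complete : (Submodule.span ℂ {f : Lp ℂ 2 (μ.restrict Ω) |
    ∃ χ ∈ Λ, f =ᵐ[μ.restrict Ω] fun x => (χ x : ℂ)}).topologicalClosure = ⊤

/-- `Ω` is spectral: it has a spectrum. -/
def IsSpectral {G : Type*} [AddCommGroup G] [TopologicalSpace G] [MeasurableSpace G]
    (μ : Measure G) (Ω : Set G) : Prop :=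
  ∃ Λ : Set (AddChar G Circle), IsSpectrum μ Ω Λ

/-- The set `A + [0,1)^d` in `ℝ^d`, for a finite set `A` of points of `ℤ^d`: a finite union of
unit cubes placed at points with integer coordinates. -/
def unionOfUnitCubes {d : ℕ} (A : Finset (Fin d → ℤ)) : Set (Fin d → ℝ) :=
  ⋃ a ∈ A, {x | ∀ i, x i ∈ Set.Ico (a i : ℝ) ((a i : ℝ) + 1)}

end

/-! The obstruction to spectrality is that fewer than `#A` characters can be pairwise orthogonal on
`A`. For a tile `B` of a finite group it holds as soon as the transform of `B` has no zero among the
differences of a set of characters which has as many elements as the tiling complement of `B` and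
which does not tile a subgroup of the dual group containing it. The rows of a `6 × 6` Hadamard
matrix of cube roots of unity are such a set, as `6` does not divide `3 ^ 5`; the tile has a layer
for each weight vector `w ∈ (ℤ/6)^5` such that `0, w 0, …, w 4` are distinct, and a nonnegative
contribution of every layer prevents cancellation in the transform.

The part of the preimage of `B` in a large box of `ℤ^d` still has few orthogonal characters, by the
pigeonhole principle in the dual torus. In `ℤ^d`, Parseval's identity for the indicator function of
one point gives `#Λ = #A` for a spectrum `Λ` of `A`. In `ℝ^d`, at most `#A - 1` frequencies of a
spectrum of the union of cubes lie in any unit cube, whereas averaging Parseval's identity for one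
of the cubes over all frequencies in a unit cube shows that at least `#A` lie in one on average.
-/

open Finset

section FiniteGroups

variable {G K L : Type*} [AddCommGroup G] [AddCommGroup K] [AddCommGroup L]

/-- The Fourier transform of the indicator function of the finite set `A`. -/
noncomputable def charSum (A : Finset G) (χ : AddChar G Circle) : ℂ :=
  ∑ x ∈ A, (χ x : ℂ)

/-- Every finite set of characters which are pairwise orthogonal on the finite set `A` has fewer
elements than `A`. This is a form of non-spectrality which passes between groups. -/
def HasFewOrthogonalCharacters (A : Finset G) : Prop :=
  ∀ S : Finset (AddChar G Circle),
    (S : Set (AddChar G Circle)).Pairwise (fun χ ψ => charSum A (χ - ψ) = 0) → #S < #A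

lemma HasFewOrthogonalCharacters.nonempty {A : Finset G} (hA : HasFewOrthogonalCharacters A) :
    A.Nonempty :=
  card_pos.1 (by simpa using hA ∅ (by simp))

lemma HasFewOrthogonalCharacters.card_lt_of_pairwise {A : Finset G}
    (hA : HasFewOrthogonalCharacters A) {J : Type*} {s : Finset J} {χ : J → AddChar G Circle}
    (h : (s : Set J).Pairwise fun i j => charSum A (χ i - χ j) = 0) : #s < #A := by
  classical
  have hinj : Set.InjOn χ s := by
    intro i hi j hj hij
    by_contra hne
    have := h hi hj hne
    simp [hij, charSum, hA.nonempty.ne_empty] at this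
  rw [← card_image_of_injOn hinj]
  refine hA _ ?_
  rw [coe_image, hinj.pairwise_image]
  exact h

lemma isComplement_preimage_subtype {H : AddSubgroup G} {S T : Set G} (hT : T ⊆ H)
    (h : AddSubgroup.IsComplement S T) :
    AddSubgroup.IsComplement ((↑) ⁻¹' S : Set H) ((↑) ⁻¹' T : Set H) := by
  rw [AddSubgroup.isComplement_iff_existsUnique_add_neg_mem] at h ⊢
  intro g
  obtain ⟨t, ht, huniq⟩ := h g
  refine ⟨⟨⟨t, hT t.2⟩, t.2⟩, ht, fun u hu => ?_⟩
  ext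
  exact congrArg (fun t : T => (t : G)) (huniq ⟨u, u.2⟩ hu)

lemma card_mul_card_lt_of_not_dvd [Finite G] {S C : Finset G} {H : AddSubgroup G}
    (hC : (C : Set G) ⊆ H) (hinj : Set.InjOn (fun p : G × G => p.1 + p.2) (S ×ˢ C : Finset (G × G)))
    (hdvd : ¬ #C ∣ Nat.card H) : #S * #C < Nat.card G := by
  by_contra! hle
  have hcompl : AddSubgroup.IsComplement (S : Set G) C := by
    refine Function.Injective.bijective_of_nat_card_le (fun p q h => ?_) ?_
    · have := @hinj (p.1, p.2) (by simp) (q.1, q.2) (by simp) h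
      rwa [Prod.mk.injEq, ← Subtype.ext_iff, ← Subtype.ext_iff, ← Prod.ext_iff] at this
    · simpa using hle
  have hcard : Nat.card ((↑) ⁻¹' (C : Set G) : Set H) = #C := by
    rw [Nat.card_preimage_of_injective Subtype.val_injective (by simpa using hC)]
    simp
  exact hdvd (hcard ▸ Dvd.intro_left _ (isComplement_preimage_subtype hC hcompl).card_mul_card)

lemma card_addChar_circle [Finite G] : Nat.card (AddChar G Circle) = Nat.card G := by
  have := Fintype.ofFinite G
  rw [Nat.card_congr AddChar.circleEquivComplex.toEquiv, Nat.card_eq_fintype_card, AddChar.card_eq,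
    Nat.card_eq_fintype_card]

/-- A set of characters pairwise orthogonal on `A` packs the dual group with the set `C`. Equality
of the cardinalities would make both sets tile the dual group, and then `C` would tile `H`. -/
lemma hasFewOrthogonalCharacters_of_not_dvd [Finite G] {A : Finset G} {T : Set G}
    (hT : AddSubgroup.IsComplement (A : Set G) T) {C : Finset (AddChar G Circle)}
    {H : AddSubgroup (AddChar G Circle)} (hCH : (C : Set (AddChar G Circle)) ⊆ H)
    (hC : ∀ χ ∈ C, ∀ ψ ∈ C, charSum A (χ - ψ) ≠ 0) (hcard : Nat.card T = #C)
    (hdvd : ¬ #C ∣ Nat.card H) : HasFewOrthogonalCharacters A := by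
  intro S hS
  have : Finite (AddChar G Circle) := .of_equiv _ AddChar.circleEquivComplex.symm.toEquiv
  have hinj : Set.InjOn (fun p : AddChar G Circle × AddChar G Circle => p.1 + p.2)
      (S ×ˢ C : Finset _) := by
    rintro ⟨χ, c⟩ hχ ⟨ψ, c'⟩ hψ h
    simp only [coe_product, Set.mem_prod, mem_coe] at hχ hψ h
    have hsub : χ - ψ = c' - c := by rw [sub_eq_sub_iff_add_eq_add, h, add_comm]
    have hχψ : χ = ψ := by
      by_contra hne
      exact hC c' hψ.2 c hχ.2 (hsub ▸ hS hχ.1 hψ.1 hne)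
    simp_all
  have hlt := card_mul_card_lt_of_not_dvd hCH hinj hdvd
  rw [card_addChar_circle, ← hT.card_mul_card, hcard, Nat.card_coe_set_eq, Set.ncard_coe_finset]
    at hlt
  exact lt_of_mul_lt_mul_right hlt (Nat.zero_le _)

open scoped ComplexOrder in
lemma sum_addSubgroup_nonneg (H : AddSubgroup G) [Fintype H] (χ : AddChar G Circle) :
    0 ≤ ∑ x : H, (χ x : ℂ) := by
  classical
  calc 0 ≤ ∑ x : H, Circle.coeHom.compAddChar (χ.compAddMonoidHom H.subtype) x := by
        rw [AddChar.sum_eq_ite]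
        split_ifs <;> positivity
    _ = ∑ x : H, (χ x : ℂ) := rfl

/-- The set cut out in the layer `index x = v` by the equation `form v x = 0`. -/
noncomputable def layeredTile [Fintype G] [DecidableEq K] (index : G →+ L) (form : L → G →+ K) :
    Finset G :=
  {x | form (index x) x = 0}

variable [Fintype G] [DecidableEq K]

lemma isComplement_layeredTile {index : G →+ L} {form : L → G →+ K} {T : Set G}
    (hindex : ∀ t ∈ T, index t = 0) (hform : ∀ v, Set.BijOn (form v) T Set.univ) :
    AddSubgroup.IsComplement (layeredTile index form : Set G) T := by
  rw [AddSubgroup.isComplement_iff_existsUnique_add_neg_mem]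
  intro g
  have key (t : T) : g + -(t : G) ∈ (layeredTile index form : Set G) ↔
      form (index g) t = form (index g) g := by
    simp [layeredTile, hindex t t.2, add_neg_eq_zero, eq_comm (a := form (index g) t)]
  obtain ⟨t, ht, hgt⟩ := (hform (index g)).surjOn (Set.mem_univ (form (index g) g))
  exact ⟨⟨t, ht⟩, (key _).2 hgt, fun u hu =>
    Subtype.ext <| (hform (index g)).injOn u.2 ht (((key u).1 hu).trans hgt.symm)⟩

lemma sum_layer_eq_sum_addSubgroup [DecidableEq L] {index : G →+ L} {form : L → G →+ K}
    {χ : AddChar G Circle} {g : G} (hform : ∀ v, form v g = 0) (hχ : χ g = 1)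
    [Fintype (index.ker ⊓ (form (index g)).ker : AddSubgroup G)] :
    ∑ x ∈ layeredTile index form with index x = index g, (χ x : ℂ) =
      ∑ x : (index.ker ⊓ (form (index g)).ker : AddSubgroup G), (χ x : ℂ) := by
  refine sum_bij' (fun x hx => ⟨x - g, ?_⟩) (fun x _ => g + x) ?_ ?_ ?_ ?_ ?_
  · simp only [layeredTile, mem_filter] at hx
    simp only [AddSubgroup.mem_inf, AddMonoidHom.mem_ker, map_sub, hx.2, hform]
    simpa [hx.2] using hx.1
  · simp
  · rintro ⟨x, hx⟩ -
    rw [AddSubgroup.mem_inf, AddMonoidHom.mem_ker, AddMonoidHom.mem_ker] at hx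
    simp [layeredTile, hform, hx]
  · simp
  · simp
  · simp [AddChar.map_sub_eq_div, hχ]

open scoped ComplexOrder in
lemma charSum_layeredTile_ne_zero [Finite L] {index : G →+ L} {form : L → G →+ K}
    {χ : AddChar G Circle}
    (hlift : ∀ v, ∃ g, index g = v ∧ (∀ w, form w g = 0) ∧ χ g = 1)
    (htriv : ∃ v, ∀ x, index x = 0 → form v x = 0 → χ x = 1) :
    charSum (layeredTile index form) χ ≠ 0 := by
  classical
  have := Fintype.ofFinite L
  have hlayer (v : L) : ∑ x ∈ layeredTile index form with index x = v, (χ x : ℂ) =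
      ∑ x : (index.ker ⊓ (form v).ker : AddSubgroup G), (χ x : ℂ) := by
    obtain ⟨g, rfl, hform, hχ⟩ := hlift v
    exact sum_layer_eq_sum_addSubgroup hform hχ
  rw [charSum, ← sum_fiberwise _ index]
  simp only [hlayer]
  obtain ⟨v, hv⟩ := htriv
  refine (sum_pos' (fun _ _ => sum_addSubgroup_nonneg _ χ) ⟨v, mem_univ v, ?_⟩).ne'
  have hone (x : (index.ker ⊓ (form v).ker : AddSubgroup G)) : (χ x : ℂ) = 1 := by
    rw [hv x x.2.1 x.2.2, Circle.coe_one]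
  simp only [hone, sum_const, card_univ, nsmul_one, Nat.cast_pos, Fintype.card_pos]

end FiniteGroups

section DotProductCharacters

variable {G R ι : Type*} [AddCommGroup G] [CommRing R] [Fintype ι]

/-- The character `x ↦ ψ (a · x)` of `R^ι`, as a function of `a`. -/
noncomputable def dotChar (ψ : AddChar R Circle) : (ι → R) →+ AddChar (ι → R) Circle where
  toFun a := ψ.compAddMonoidHom (dotProductBilin R R a).toAddMonoidHom
  map_zero' := by ext x; simp
  map_add' a b := by ext x; simp [AddChar.map_add_eq_mul]

/-- Restriction of characters along a homomorphism of groups. -/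
noncomputable def charPullback {H : Type*} [AddCommGroup H] (p : G →+ H) :
    AddChar H Circle →+ AddChar G Circle where
  toFun χ := χ.compAddMonoidHom p
  map_zero' := rfl
  map_add' _ _ := rfl

@[simp] lemma dotChar_apply (ψ : AddChar R Circle) (a x : ι → R) : dotChar ψ a x = ψ (a ⬝ᵥ x) :=
  rfl

@[simp] lemma charPullback_apply {H : Type*} [AddCommGroup H] (p : G →+ H) (χ : AddChar H Circle)
    (x : G) : charPullback p χ x = χ (p x) :=
  rfl

lemma dotChar_injective {ψ : AddChar R Circle} (hψ : Function.Injective ψ) :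
    Function.Injective (dotChar ψ : (ι → R) →+ AddChar (ι → R) Circle) := by
  classical
  intro a b h
  ext i
  apply hψ
  simpa using DFunLike.congr_fun h (Pi.single i 1)

end DotProductCharacters

section ExhaustingWeights

/-- The weights `0, w 0, …, w (r - 1)` run through every residue modulo `m` exactly once. -/
def IsExhausting {r m : ℕ} (w : Fin r → ZMod m) : Prop :=
  Function.Bijective (Fin.cons 0 w : Fin (r + 1) → ZMod m)

variable {r m : ℕ} {G L : Type*} [AddCommGroup G] [AddCommGroup L]

/-- The tile which consists, in the layer above `v`, of the points whose digits `y` satisfy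
`ω v · y = 0`. The homomorphism `f` sends a point to its digits and its layer. -/
noncomputable def weightedTile [Fintype G] (f : G →+ (Fin r → ZMod m) × L)
    (ω : L → {w : Fin r → ZMod m // IsExhausting w}) : Finset G :=
  layeredTile ((AddMonoidHom.snd _ _).comp f)
    fun v => (dotProductBilin ℤ ℤ (ω v : Fin r → ZMod m)).toAddMonoidHom.comp
      ((AddMonoidHom.fst _ _).comp f)

end ExhaustingWeights

section WeightedTiles

variable {r m : ℕ} {G L : Type*} [AddCommGroup G] [AddCommGroup L]

/-- The character `x ↦ exp (2πi (c · y) / q)`, where `y` is the vector of the digits of `x`, which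
are residues modulo a multiple of `q`. -/
noncomputable def digitChar {q : ℕ} [NeZero q] (hq : q ∣ m) (f : G →+ (Fin r → ZMod m) × L) :
    (Fin r → ZMod q) →+ AddChar G Circle :=
  (charPullback (((ZMod.castHom hq (ZMod q)).toAddMonoidHom.compLeft (Fin r)).comp
    ((AddMonoidHom.fst _ _).comp f))).comp (dotChar ZMod.toCircle)

lemma digitChar_apply {q : ℕ} [NeZero q] (hq : q ∣ m) (f : G →+ (Fin r → ZMod m) × L)
    (c : Fin r → ZMod q) (x : G) :
    digitChar hq f c x = ZMod.toCircle (c ⬝ᵥ fun i => ZMod.castHom hq (ZMod q) ((f x).1 i)) :=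
  rfl

lemma digitChar_injective {q : ℕ} [NeZero q] (hq : q ∣ m) {f : G →+ (Fin r → ZMod m) × L}
    (hf : Function.Surjective f) : Function.Injective (digitChar hq f) :=
  (AddChar.compAddMonoidHom_injective_left _
    ((ZMod.castHom_surjective hq).comp_left.comp (Prod.fst_surjective.comp hf))).comp
    (dotChar_injective ZMod.injective_toCircle)

lemma exists_isComplement_weightedTile [Fintype G] {f : G →+ (Fin r → ZMod m) × L}
    (hf : Function.Surjective f) (ω : L → {w : Fin r → ZMod m // IsExhausting w}) :
    ∃ T : Set G, AddSubgroup.IsComplement (weightedTile f ω : Set G) T ∧ Nat.card T = r + 1 := by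
  choose lift hlift using hf
  let t : Fin (r + 1) → G := Fin.cons (lift 0) fun i => lift (Pi.single i 1, 0)
  have hindex : ∀ x ∈ Set.range t, (f x).2 = 0 := by
    rintro _ ⟨k, rfl⟩
    cases k using Fin.cases <;> simp [t, hlift]
  have hform (v : L) : (fun k => (ω v : Fin r → ZMod m) ⬝ᵥ (f (t k)).1) =
      Fin.cons 0 (ω v : Fin r → ZMod m) := by
    ext k
    cases k using Fin.cases <;> simp [t, hlift]
  have hbij (v : L) : Function.Bijective fun k => (ω v : Fin r → ZMod m) ⬝ᵥ (f (t k)).1 :=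
    hform v ▸ (ω v).2
  have hinj : Function.Injective t := fun k l h => (hbij 0).injective (by simp only [h])
  refine ⟨Set.range t, isComplement_layeredTile hindex fun v => ?_, ?_⟩
  · refine ⟨Set.mapsTo_univ _ _, ?_, fun y _ => ?_⟩
    · rintro _ ⟨k, rfl⟩ _ ⟨l, rfl⟩ h
      rw [(hbij v).injective h]
    · obtain ⟨k, hk⟩ := (hbij v).surjective y
      exact ⟨t k, ⟨k, rfl⟩, hk⟩
  · rw [Nat.card_congr (Equiv.ofInjective t hinj).symm, Nat.card_fin]

lemma charSum_weightedTile_digitChar_ne_zero [Fintype G] [Finite L] {q : ℕ} [NeZero q]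
    (hq : q ∣ m) {f : G →+ (Fin r → ZMod m) × L} (hf : Function.Surjective f)
    (ω : L → {w : Fin r → ZMod m // IsExhausting w}) (v : L) :
    charSum (weightedTile f ω)
      (digitChar hq f fun i => ZMod.castHom hq (ZMod q) ((ω v : Fin r → ZMod m) i)) ≠ 0 := by
  refine charSum_layeredTile_ne_zero (fun u => ?_) ⟨v, fun x _ hx => ?_⟩
  · obtain ⟨g, hg⟩ := hf (0, u)
    exact ⟨g, by simp [hg], by simp [hg], by simp [digitChar_apply, hg, dotProduct]⟩
  · have hdot : (ω v : Fin r → ZMod m) ⬝ᵥ (f x).1 = 0 := hx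
    rw [digitChar_apply, ← AddChar.map_zero_eq_one (ZMod.toCircle (N := q)),
      ← map_zero (ZMod.castHom hq (ZMod q)), ← hdot]
    simp only [dotProduct, map_sum, map_mul]

/-- Differences of distinct rows of `D` lift to exhausting weights modulo `m`. In particular `D`,
with a column of zeros added, is the matrix of exponents of a Hadamard matrix of `q`-th roots of
unity. -/
def HasExhaustingDifferences {q : ℕ} (hq : q ∣ m) (D : Fin (r + 1) → Fin r → ZMod q) : Prop :=
  ∀ k l, k ≠ l → ∃ w : Fin r → ZMod m, IsExhausting w ∧
    (fun i => ZMod.castHom hq (ZMod q) (w i)) = D k - D l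

theorem hasFewOrthogonalCharacters_weightedTile [Fintype G] [Finite L] {q : ℕ} [NeZero q]
    {hq : q ∣ m} {D : Fin (r + 1) → Fin r → ZMod q} (hD : HasExhaustingDifferences hq D)
    (hinj : Function.Injective D) (hrq : ¬ r + 1 ∣ q ^ r)
    {f : G →+ (Fin r → ZMod m) × L} (hf : Function.Surjective f)
    {ω : L → {w : Fin r → ZMod m // IsExhausting w}} (hω : Function.Surjective ω) :
    HasFewOrthogonalCharacters (weightedTile f ω) := by
  obtain ⟨T, hT, hTcard⟩ := exists_isComplement_weightedTile hf ω
  let C : Finset (AddChar G Circle) := univ.image fun k => digitChar hq f (D k)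
  have hCcard : #C = r + 1 :=
    (card_image_of_injective univ ((digitChar_injective hq hf).comp hinj)).trans (card_fin _)
  refine hasFewOrthogonalCharacters_of_not_dvd hT (C := C) (H := (digitChar hq f).range)
    ?_ ?_ (hTcard.trans hCcard.symm) ?_
  · simp [C, Set.range_subset_iff]
  · simp only [C, mem_image, mem_univ, true_and, forall_exists_index, forall_apply_eq_imp_iff,
      ← map_sub]
    intro k l
    by_cases hkl : k = l
    · have := hT.nonempty_left
      simpa [hkl, charSum, ← nonempty_iff_ne_empty] using this
    · obtain ⟨w, hw, hred⟩ := hD k l hkl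
      obtain ⟨v, hv⟩ := hω ⟨w, hw⟩
      simpa only [hv, hred] using charSum_weightedTile_digitChar_ne_zero hq hf ω v
  · rw [hCcard]
    refine fun h => hrq (h.trans ?_)
    simpa using AddSubgroup.card_range_dvd (digitChar hq f)

end WeightedTiles

section Tile

/-- The exponents of a normalized `6 × 6` Hadamard matrix of cube roots of unity, without the column
of zeros. -/
def hadamardExponents : Fin 6 → Fin 5 → ZMod 3 :=
  ![![0, 0, 0, 0, 0], ![0, 1, 1, 2, 2], ![1, 0, 2, 1, 2], ![1, 2, 0, 2, 1], ![2, 1, 2, 0, 1],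
    ![2, 2, 1, 1, 0]]

/-- The vector of residues modulo `6` which reduces to `u` modulo `3` and whose residues modulo `2`
separate equal entries of the vector `(0, u 0, …, u 4)`. -/
def sixfoldLift (u : Fin 5 → ZMod 3) (i : Fin 5) : ZMod 6 :=
  4 * (u i).val + 3 * #{j : Fin 6 | j < i.succ ∧ (Fin.cons 0 u : Fin 6 → ZMod 3) j = u i}

lemma hadamardExponents_injective : Function.Injective hadamardExponents := by
  decide +kernel

lemma hasExhaustingDifferences_hadamardExponents :
    HasExhaustingDifferences (by norm_num : 3 ∣ 6) hadamardExponents := by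
  intro k l hkl
  refine ⟨sixfoldLift (hadamardExponents k - hadamardExponents l), ?_, ?_⟩
  · rw [IsExhausting, Fintype.bijective_iff_injective_and_card]
    refine ⟨?_, by simp [ZMod.card]⟩
    revert k l
    unfold Function.Injective
    decide +kernel
  · revert k l
    decide +kernel

lemma exists_surjective_exhausting :
    ∃ ω : ZMod (6 ^ 5 + 1) → {w : Fin 5 → ZMod 6 // IsExhausting w}, Function.Surjective ω := by
  obtain ⟨w, hw, -⟩ := hasExhaustingDifferences_hadamardExponents 0 1 (by decide)
  have : Nonempty {w : Fin 5 → ZMod 6 // IsExhausting w} := ⟨w, hw⟩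
  classical
  obtain ⟨e⟩ := Function.Embedding.nonempty_of_card_le
    (α := {w : Fin 5 → ZMod 6 // IsExhausting w}) (β := ZMod (6 ^ 5 + 1)) <|
      (Fintype.card_subtype_le _).trans (by simp [ZMod.card])
  exact ⟨Function.invFun e, Function.invFun_surjective e.injective⟩

/-- The digits and the layer of a point of `(ℤ/ab)^ι`: the residues modulo `a` of the coordinates
selected by `e`, and the residue modulo `b` of one coordinate. -/
def digitsAndLayer {ι : Type*} {r a b : ℕ} (hab : a.Coprime b) (e : Fin r → ι)
    (i₀ : ι) : (ι → ZMod (a * b)) →+ (Fin r → ZMod a) × ZMod b where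
  toFun x :=
    (fun k => (ZMod.chineseRemainder hab (x (e k))).1, (ZMod.chineseRemainder hab (x i₀)).2)
  map_zero' := by ext <;> simp
  map_add' x y := by ext <;> simp

lemma digitsAndLayer_surjective {ι : Type*} {r a b : ℕ} (hab : a.Coprime b) {e : Fin r → ι}
    (he : Function.Injective e) (i₀ : ι) : Function.Surjective (digitsAndLayer hab e i₀) := by
  rintro ⟨u, v⟩
  refine ⟨fun i => (ZMod.chineseRemainder hab).symm (Function.extend e u 0 i, v), ?_⟩
  ext <;> simp [digitsAndLayer, he.extend_apply]

theorem exists_hasFewOrthogonalCharacters_isComplement {d : ℕ} (hd : 5 ≤ d) :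
    ∃ N : ℕ, N ≠ 0 ∧ ∃ (B : Finset (Fin d → ZMod N)) (T : Set (Fin d → ZMod N)),
      HasFewOrthogonalCharacters B ∧ AddSubgroup.IsComplement (B : Set (Fin d → ZMod N)) T := by
  obtain ⟨ω, hω⟩ := exists_surjective_exhausting
  have hf := digitsAndLayer_surjective (by norm_num : Nat.Coprime 6 (6 ^ 5 + 1))
    (Fin.castLE_injective hd) ⟨0, by lia⟩
  obtain ⟨T, hT, -⟩ := exists_isComplement_weightedTile hf ω
  exact ⟨6 * (6 ^ 5 + 1), by norm_num, _, T, hasFewOrthogonalCharacters_weightedTile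
    hasExhaustingDifferences_hadamardExponents hadamardExponents_injective (by norm_num) hf hω, hT⟩

end Tile

section LatticeCharacters

open scoped FourierTransform

lemma addChar_eq_prod_single {ι A M : Type*} [Fintype ι] [DecidableEq ι] [AddCommMonoid A]
    [CommMonoid M] (χ : AddChar (ι → A) M) (x : ι → A) : χ x = ∏ i, χ (Pi.single i (x i)) := by
  conv_lhs => rw [← univ_sum_single x]
  exact map_prod χ.toMonoidHom (fun i => Multiplicative.ofAdd (Pi.single i (x i))) univ

lemma fourierChar_eq_one_iff {x : ℝ} : 𝐞 x = 1 ↔ ∃ m : ℤ, x = m := by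
  simp [Real.fourierChar_apply', Circle.exp_eq_one, mul_comm, Real.pi_ne_zero]

lemma fourierChar_surjective : Function.Surjective 𝐞 := fun z => by
  obtain ⟨t, rfl⟩ := Circle.exp_surjective z
  exact ⟨t / (2 * Real.pi), by rw [Real.fourierChar_apply']; congr 1; field_simp⟩

variable {ι : Type*}

/-- The inclusion of `ℤ^ι` into `ℝ^ι`. -/
def latticeInclusion (ι : Type*) : (ι → ℤ) →+ (ι → ℝ) :=
  (Int.castAddHom ℝ).compLeft ι

@[simp] lemma latticeInclusion_apply (x : ι → ℤ) (i : ι) : latticeInclusion ι x i = x i :=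
  rfl

/-- Reduction modulo `N` of the coordinates of a lattice point. -/
def latticeReduction (ι : Type*) (N : ℕ) : (ι → ℤ) →+ (ι → ZMod N) :=
  (Int.castAddHom (ZMod N)).compLeft ι

@[simp] lemma latticeReduction_apply (N : ℕ) (x : ι → ℤ) (i : ι) :
    latticeReduction ι N x i = x i :=
  rfl

/-- The character `x ↦ exp (2πi θ · x)` of `ℤ^ι`, as a function of `θ`. -/
noncomputable def latticeChar [Fintype ι] : (ι → ℝ) →+ AddChar (ι → ℤ) Circle :=
  (charPullback (latticeInclusion ι)).comp (dotChar 𝐞)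

lemma latticeChar_apply [Fintype ι] (θ : ι → ℝ) (x : ι → ℤ) :
    latticeChar θ x = 𝐞 (θ ⬝ᵥ latticeInclusion ι x) :=
  rfl

lemma latticeChar_single [Fintype ι] [DecidableEq ι] (θ : ι → ℝ) (i : ι) (k : ℤ) :
    latticeChar θ (Pi.single i k) = 𝐞 (θ i * k) := by
  have : latticeInclusion ι (Pi.single i k) = Pi.single i (k : ℝ) := by
    ext j
    rcases eq_or_ne j i with rfl | h <;> simp_all
  rw [latticeChar_apply, this, dotProduct_single]

lemma latticeChar_surjective [Fintype ι] :
    Function.Surjective (latticeChar : (ι → ℝ) →+ AddChar (ι → ℤ) Circle) := by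
  classical
  intro χ
  choose θ hθ using fun i => fourierChar_surjective (χ (Pi.single i 1))
  refine ⟨θ, ?_⟩
  ext x
  congr 1
  rw [addChar_eq_prod_single, addChar_eq_prod_single χ]
  refine prod_congr rfl fun i _ => ?_
  have hsingle : (Pi.single i (x i) : ι → ℤ) = x i • Pi.single i 1 := by simp [← Pi.single_smul]
  rw [hsingle, AddChar.map_zsmul_eq_zpow, AddChar.map_zsmul_eq_zpow, latticeChar_single, ← hθ,
    Int.cast_one, mul_one]

lemma latticeChar_div_intCast [Fintype ι] {N : ℕ} [NeZero N] (a : ι → ℤ) :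
    latticeChar (fun i => (a i : ℝ) / N) =
      charPullback (latticeReduction ι N) (dotChar ZMod.toCircle fun i => (a i : ZMod N)) := by
  ext x
  have : (fun i => (a i : ZMod N)) ⬝ᵥ latticeReduction ι N x = ((a ⬝ᵥ x : ℤ) : ZMod N) := by
    simp [dotProduct]
  rw [charPullback_apply, dotChar_apply, this, ZMod.toCircle_intCast, latticeChar_apply,
    Real.fourierChar_apply]
  congr 1
  simp only [dotProduct, latticeInclusion_apply]
  push_cast
  simp only [mul_sum, sum_mul, sum_div]
  exact sum_congr rfl fun i _ => by ring

/-- The integer part of `N θ`, where `χ = exp (2πi θ · x)`, gives the character of `(ℤ/N)^ι`. -/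
lemma exists_eq_charPullback_add_latticeChar [Fintype ι] (N : ℕ) [NeZero N]
    (χ : AddChar (ι → ℤ) Circle) :
    ∃ (α : AddChar (ι → ZMod N) Circle) (ε : ι → ℝ), (∀ i, ε i ∈ Set.Ico 0 1) ∧
      χ = charPullback (latticeReduction ι N) α + latticeChar ((N : ℝ)⁻¹ • ε) := by
  obtain ⟨θ, rfl⟩ := latticeChar_surjective χ
  refine ⟨dotChar ZMod.toCircle fun i => ⌊N * θ i⌋, fun i => Int.fract (N * θ i),
    fun i => ⟨Int.fract_nonneg _, Int.fract_lt_one _⟩, ?_⟩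
  rw [← latticeChar_div_intCast, ← map_add]
  congr 1
  ext i
  have hN : (N : ℝ) ≠ 0 := NeZero.ne _
  simp only [Pi.add_apply, Pi.smul_apply, smul_eq_mul]
  rw [inv_mul_eq_div, ← add_div, Int.floor_add_fract, mul_div_cancel_left₀ _ hN]

lemma sum_range_fourierChar_mul_ne_zero {n : ℕ} (hn : n ≠ 0) {δ : ℝ} (hδ : |δ| < 1 / n) :
    ∑ k ∈ range n, (𝐞 (δ * k) : ℂ) ≠ 0 := by
  have hpow (k : ℕ) : 𝐞 (δ * k) = 𝐞 δ ^ k := by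
    rw [← AddChar.map_nsmul_eq_pow, nsmul_eq_mul, mul_comm]
  simp only [hpow, Circle.coe_pow]
  intro hsum
  have hn' : (0 : ℝ) < n := by positivity
  have hone : 𝐞 (δ * n) = 1 := by
    have := mul_geom_sum (𝐞 δ : ℂ) n
    rw [hsum, mul_zero] at this
    rw [hpow, Circle.ext_iff, Circle.coe_pow, Circle.coe_one, ← sub_eq_zero, ← this]
  obtain ⟨m, hm⟩ := fourierChar_eq_one_iff.1 hone
  have hm0 : m = 0 := by
    rw [← Int.abs_lt_one_iff]
    rw [lt_div_iff₀ hn', ← abs_of_pos hn', ← abs_mul, hm] at hδ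
    exact_mod_cast hδ
  have hδ0 : δ = 0 := by simpa [hm0, hn] using hm
  simp [hδ0, hn] at hsum

end LatticeCharacters

section LiftBox

open scoped FourierTransform

variable {ι : Type*} {N n : ℕ}

/-- The smallest nonnegative lattice point in a class modulo `N`. -/
def leastLift (b : ι → ZMod N) : ι → ℤ := fun i => (b i).val

lemma latticeReduction_leastLift [NeZero N] (b : ι → ZMod N) :
    latticeReduction ι N (leastLift b) = b := by
  ext i
  simp [leastLift]

lemma leastLift_latticeReduction_add [NeZero N] {x : ι → ℤ} (hx : ∀ i, 0 ≤ x i) :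
    (leastLift (latticeReduction ι N x) + fun i => (N : ℤ) * ((x i / N).toNat : ℕ)) = x := by
  ext i
  have : 0 ≤ x i / N := Int.ediv_nonneg (hx i) (by positivity)
  simp only [Pi.add_apply, leastLift, latticeReduction_apply, ZMod.val_intCast,
    Int.toNat_of_nonneg this]
  exact Int.emod_add_mul_ediv _ _

lemma leastLift_add_mul_ediv [NeZero N] (b : ι → ZMod N) (k : ι → ℕ) (i : ι) :
    (leastLift b i + (N : ℤ) * k i) / N = k i := by
  have hN : (N : ℤ) ≠ 0 := by exact_mod_cast NeZero.ne N
  have hb : leastLift b i / N = 0 :=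
    Int.ediv_eq_zero_of_lt (by simp only [leastLift]; positivity)
      (by simpa only [leastLift] using mod_cast ZMod.val_lt (b i))
  rw [Int.add_mul_ediv_left _ _ hN, hb, zero_add]

variable [Fintype ι]

/-- At `δ = 0` the sum is `charSum B α`, and there are only finitely many characters `α`. -/
lemma exists_forall_sum_ne_zero [NeZero N] (B : Finset (ι → ZMod N)) :
    ∃ n : ℕ, n ≠ 0 ∧ ∀ α : AddChar (ι → ZMod N) Circle, charSum B α ≠ 0 → ∀ δ : ι → ℝ,
      (∀ i, |δ i| < 1 / n) →
        ∑ b ∈ B, (α b * latticeChar ((N : ℝ)⁻¹ • δ) (leastLift b) : ℂ) ≠ 0 := by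
  have : Finite (AddChar (ι → ZMod N) Circle) := .of_equiv _ AddChar.circleEquivComplex.symm.toEquiv
  have hnhds : ∀ᶠ δ : ι → ℝ in nhds 0, ∀ α : AddChar (ι → ZMod N) Circle, charSum B α ≠ 0 →
      ∑ b ∈ B, (α b * latticeChar ((N : ℝ)⁻¹ • δ) (leastLift b) : ℂ) ≠ 0 := by
    refine Filter.eventually_all.2 fun α => Filter.eventually_imp_distrib_left.2 fun hα => ?_
    have hcont : Continuous fun δ : ι → ℝ =>
        ∑ b ∈ B, (α b * latticeChar ((N : ℝ)⁻¹ • δ) (leastLift b) : ℂ) := by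
      simp only [latticeChar_apply, dotProduct]
      have := Real.continuous_fourierChar
      fun_prop
    refine hcont.continuousAt.eventually_ne ?_
    simpa [charSum] using hα
  obtain ⟨r, hr, hball⟩ := Metric.eventually_nhds_iff.1 hnhds
  obtain ⟨n, hn⟩ := exists_nat_one_div_lt hr
  refine ⟨n + 1, n.succ_ne_zero, fun α hα δ hδ => hball ?_ α hα⟩
  rw [dist_zero_right, pi_norm_lt_iff hr]
  exact fun i => (hδ i).trans (by exact_mod_cast hn)

/-- Pigeonhole principle for the partition of `[0, 1)^ι` into cubes of side `1 / n`. -/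
lemma exists_subset_forall_abs_sub_lt {κ : Type*} {S : Finset κ} {ε : κ → ι → ℝ} {m : ℕ}
    (hn : n ≠ 0) (hε : ∀ s i, ε s i ∈ Set.Ico 0 1) (hm : n ^ Fintype.card ι * m ≤ #S) :
    ∃ F ⊆ S, m ≤ #F ∧ ∀ s ∈ F, ∀ t ∈ F, ∀ i, |(ε s - ε t) i| < 1 / n := by
  classical
  have hn' : (0 : ℝ) < n := by positivity
  let bin (s : κ) (i : ι) : ℤ := ⌊n * ε s i⌋
  have hbin : ∀ s ∈ S, bin s ∈ Fintype.piFinset fun _ : ι => Ico 0 (n : ℤ) := by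
    intro s _
    simp only [bin, Fintype.mem_piFinset, mem_Ico, Int.floor_nonneg, Int.floor_lt, Int.cast_natCast]
    exact fun i => ⟨mul_nonneg hn'.le (hε s i).1, mul_lt_of_lt_one_right hn' (hε s i).2⟩
  obtain ⟨c, -, hc⟩ := exists_le_card_fiber_of_mul_le_card_of_maps_to (n := m) hbin
    (Fintype.piFinset_nonempty.2 fun _ => nonempty_Ico.2 (by positivity)) (by simpa using hm)
  refine ⟨{s ∈ S | bin s = c}, filter_subset _ _, hc, fun s hs t ht i => ?_⟩
  rw [mem_filter] at hs ht
  have := Int.abs_sub_lt_one_of_floor_eq_floor (congrFun (hs.2.trans ht.2.symm) i)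
  rwa [← mul_sub, abs_mul, abs_of_pos hn', ← lt_div_iff₀' hn'] at this

variable [DecidableEq ι]

/-- The points of the box `[0, N n)^ι` whose classes modulo `N` lie in `B`. -/
noncomputable def liftBox (B : Finset (ι → ZMod N)) (n : ℕ) : Finset (ι → ℤ) :=
  {x ∈ Fintype.piFinset fun _ => Ico 0 (N * n : ℤ) | latticeReduction ι N x ∈ B}

lemma mem_liftBox {B : Finset (ι → ZMod N)} {x : ι → ℤ} :
    x ∈ liftBox B n ↔ (∀ i, 0 ≤ x i ∧ x i < N * n) ∧ latticeReduction ι N x ∈ B := by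
  simp [liftBox]

lemma sum_liftBox [NeZero N] {M : Type*} [AddCommMonoid M] (B : Finset (ι → ZMod N))
    (f : (ι → ℤ) → M) :
    ∑ x ∈ liftBox B n, f x =
      ∑ b ∈ B, ∑ k ∈ Fintype.piFinset fun _ => range n,
        f (leastLift b + fun i => (N : ℤ) * (k i : ℕ)) := by
  have hN : (0 : ℤ) < N := by exact_mod_cast NeZero.pos N
  have hreduction (b : ι → ZMod N) (k : ι → ℕ) :
      latticeReduction ι N (leastLift b + fun i => (N : ℤ) * (k i : ℕ)) = b := by
    ext i
    simp [leastLift]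
  have hlift {x : ι → ℤ} (hx : x ∈ liftBox B n) :
      (leastLift (latticeReduction ι N x) + fun i => (N : ℤ) * ((x i / N).toNat : ℕ)) = x :=
    leastLift_latticeReduction_add fun i => ((mem_liftBox.1 hx).1 i).1
  rw [← sum_product']
  refine sum_nbij' (fun x => (latticeReduction ι N x, fun i => (x i / N).toNat))
    (fun p => leastLift p.1 + fun i => (N : ℤ) * (p.2 i : ℕ)) ?_ ?_ (fun x hx => hlift hx) ?_
    fun x hx => by rw [hlift hx]
  · intro x hx
    rw [mem_liftBox] at hx
    simp only [mem_product, hx.2, Fintype.mem_piFinset, mem_range, true_and]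
    intro i
    have := Int.ediv_lt_of_lt_mul hN (mul_comm (N : ℤ) n ▸ (hx.1 i).2)
    have := Int.ediv_nonneg (hx.1 i).1 hN.le
    lia
  · rintro ⟨b, k⟩ hp
    simp only [mem_product, Fintype.mem_piFinset, mem_range] at hp
    refine mem_liftBox.2 ⟨fun i => ?_, (hreduction b k).symm ▸ hp.1⟩
    have hb : ((b i).val : ℤ) < N := by exact_mod_cast ZMod.val_lt (b i)
    have hk : (k i : ℤ) + 1 ≤ n := by exact_mod_cast hp.2 i
    simp only [Pi.add_apply, leastLift]
    exact ⟨by positivity, by nlinarith⟩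
  · rintro ⟨b, k⟩ -
    simp only [hreduction, Pi.add_apply, leastLift_add_mul_ediv, Int.toNat_natCast]

lemma card_liftBox [NeZero N] (B : Finset (ι → ZMod N)) :
    #(liftBox B n) = n ^ Fintype.card ι * #B := by
  rw [card_eq_sum_ones, sum_liftBox]
  simp [mul_comm]

lemma charSum_liftBox [NeZero N] (B : Finset (ι → ZMod N)) (χ : AddChar (ι → ℤ) Circle) :
    charSum (liftBox B n) χ =
      (∑ b ∈ B, (χ (leastLift b) : ℂ)) *
        ∏ i, ∑ k ∈ range n, (χ (Pi.single i ((N : ℤ) * k)) : ℂ) := by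
  rw [charSum, sum_liftBox, sum_mul, prod_univ_sum]
  refine sum_congr rfl fun b _ => ?_
  rw [mul_sum]
  refine sum_congr rfl fun k _ => ?_
  rw [AddChar.map_add_eq_mul, Circle.coe_mul,
    addChar_eq_prod_single χ (fun i => (N : ℤ) * (k i : ℕ))]
  congr 1
  exact map_prod Circle.coeHom _ _

lemma exists_isComplement_liftBox [NeZero N] (hn : n ≠ 0) {B : Finset (ι → ZMod N)}
    {T : Set (ι → ZMod N)} (h : AddSubgroup.IsComplement (B : Set (ι → ZMod N)) T) :
    ∃ T' : Set (ι → ℤ), AddSubgroup.IsComplement (liftBox B n : Set (ι → ℤ)) T' := by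
  have hNn : (0 : ℤ) < N * n := by have := NeZero.pos N; positivity
  let t (s : ι → ZMod N) (z : ι → ℤ) : ι → ℤ := leastLift s + (N * n : ℤ) • z
  have hreduction (s : ι → ZMod N) (z : ι → ℤ) : latticeReduction ι N (t s z) = s := by
    rw [map_add, latticeReduction_leastLift]
    ext i
    simp
  refine ⟨Set.image2 t T Set.univ, ?_⟩
  rw [AddSubgroup.isComplement_iff_existsUnique_add_neg_mem] at h ⊢
  intro x
  have key (s : ι → ZMod N) (z : ι → ℤ) : x + -t s z ∈ (liftBox B n : Set (ι → ℤ)) ↔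
      (∀ i, (x i - leastLift s i) / (N * n) = z i) ∧ latticeReduction ι N x + -s ∈ B := by
    rw [mem_coe, mem_liftBox, map_add, map_neg, hreduction]
    refine and_congr_left fun _ => forall_congr' fun i => ?_
    rw [Int.ediv_eq_iff_of_pos hNn]
    simp only [t, Pi.add_apply, Pi.neg_apply, Pi.smul_apply, smul_eq_mul]
    constructor <;> rintro ⟨h₁, h₂⟩ <;> constructor <;> linarith
  obtain ⟨s, hs, huniq⟩ := h (latticeReduction ι N x)
  refine ⟨⟨_, Set.mem_image2_of_mem s.2 (Set.mem_univ fun i =>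
    (x i - leastLift (s : ι → ZMod N) i) / (N * n))⟩, (key _ _).2 ⟨fun _ => rfl, hs⟩, ?_⟩
  rintro ⟨_, s', hs', z, _, rfl⟩ hmem
  obtain ⟨hdiv, hB⟩ := (key s' z).1 hmem
  obtain rfl : s' = s := congrArg Subtype.val (huniq ⟨s', hs'⟩ hB)
  exact Subtype.ext (congrArg (t s) (funext fun i => (hdiv i).symm))

lemma charSum_liftBox_ne_zero [NeZero N] (hn : n ≠ 0) {B : Finset (ι → ZMod N)}
    (α : AddChar (ι → ZMod N) Circle) {δ : ι → ℝ} (hδ : ∀ i, |δ i| < 1 / n)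
    (hB : ∑ b ∈ B, (α b * latticeChar ((N : ℝ)⁻¹ • δ) (leastLift b) : ℂ) ≠ 0) :
    charSum (liftBox B n)
      (charPullback (latticeReduction ι N) α + latticeChar ((N : ℝ)⁻¹ • δ)) ≠ 0 := by
  rw [charSum_liftBox]
  refine mul_ne_zero ?_ (prod_ne_zero_iff.2 fun i _ => ?_)
  · simpa [latticeReduction_leastLift] using hB
  · have hmul (k : ℕ) : latticeReduction ι N (Pi.single i ((N : ℤ) * k)) = 0 := by
      ext j
      rcases eq_or_ne j i with rfl | h <;> simp_all
    have hN : (N : ℝ) ≠ 0 := NeZero.ne _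
    have hterm (k : ℕ) : (N : ℝ)⁻¹ * δ i * (N * k) = δ i * k := by field_simp
    simpa [hmul, latticeChar_single, hterm] using sum_range_fourierChar_mul_ne_zero hn (hδ i)

theorem exists_hasFewOrthogonalCharacters_liftBox [NeZero N] {B : Finset (ι → ZMod N)}
    (hB : HasFewOrthogonalCharacters B) :
    ∃ n : ℕ, n ≠ 0 ∧ HasFewOrthogonalCharacters (liftBox B n) := by
  obtain ⟨n, hn, hne⟩ := exists_forall_sum_ne_zero B
  refine ⟨n, hn, fun S hS => ?_⟩
  by_contra! hle
  choose α ε hε hαε using exists_eq_charPullback_add_latticeChar (ι := ι) N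
  obtain ⟨F, hFS, hcard, hclose⟩ :=
    exists_subset_forall_abs_sub_lt hn hε (by rwa [card_liftBox] at hle)
  have hsub (χ ψ : AddChar (ι → ℤ) Circle) : χ - ψ =
      charPullback (latticeReduction ι N) (α χ - α ψ) +
        latticeChar ((N : ℝ)⁻¹ • (ε χ - ε ψ)) := by
    conv_lhs => rw [hαε χ, hαε ψ]
    rw [smul_sub, map_sub, map_sub]
    abel
  refine (hB.card_lt_of_pairwise (s := F) (χ := α) fun χ hχ ψ hψ hχψ => ?_).not_ge hcard
  by_contra hα
  have hδ := hclose χ hχ ψ hψ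
  refine charSum_liftBox_ne_zero hn _ hδ (hne _ hα _ hδ) ?_
  rw [← hsub]
  exact hS (hFS hχ) (hFS hψ) hχψ

end LiftBox

section OrthogonalFamilies

variable {𝕜 E J : Type*} [RCLike 𝕜] [NormedAddCommGroup E] [InnerProductSpace 𝕜 E] {v : J → E}
  {m : ℝ}

lemma orthonormal_inv_sqrt_smul (hm : 0 < m) (hv : ∀ j, ‖v j‖ ^ 2 = m)
    (horth : Pairwise fun i j => inner 𝕜 (v i) (v j) = 0) :
    Orthonormal 𝕜 fun j => ((√m : ℝ) : 𝕜)⁻¹ • v j := by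
  refine ⟨fun j => ?_, fun i j hij => ?_⟩
  · have : ‖v j‖ = √m := by rw [← hv j, Real.sqrt_sq (norm_nonneg _)]
    rw [norm_smul, norm_inv, RCLike.norm_ofReal, abs_of_nonneg (Real.sqrt_nonneg _), this,
      inv_mul_cancel₀ (Real.sqrt_ne_zero'.2 hm)]
  · simp only [inner_smul_left, inner_smul_right, horth hij, mul_zero]

lemma norm_inner_sq_eq_mul (hm : 0 < m) (x y : E) :
    ‖inner 𝕜 x y‖ ^ 2 = m * ‖inner 𝕜 (((√m : ℝ) : 𝕜)⁻¹ • x) y‖ ^ 2 := by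
  rw [inner_smul_left, norm_mul, RCLike.norm_conj, norm_inv, RCLike.norm_ofReal,
    abs_of_nonneg (Real.sqrt_nonneg _), mul_pow, inv_pow, Real.sq_sqrt hm.le,
    mul_inv_cancel_left₀ hm.ne']

lemma tsum_enorm_sq {F : Type*} [NormedAddCommGroup F] {f : J → F}
    (hf : Summable fun j => ‖f j‖ ^ 2) :
    ∑' j, ‖f j‖ₑ ^ 2 = ENNReal.ofReal (∑' j, ‖f j‖ ^ 2) := by
  rw [ENNReal.ofReal_tsum_of_nonneg (fun _ => by positivity) hf]
  exact tsum_congr fun j => by rw [ENNReal.ofReal_pow (norm_nonneg _), ofReal_norm]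

lemma tsum_enorm_inner_sq_le (hm : 0 < m) (hv : ∀ j, ‖v j‖ ^ 2 = m)
    (horth : Pairwise fun i j => inner 𝕜 (v i) (v j) = 0) (x : E) :
    ∑' j, ‖inner 𝕜 (v j) x‖ₑ ^ 2 ≤ ENNReal.ofReal (m * ‖x‖ ^ 2) := by
  have hon := orthonormal_inv_sqrt_smul hm hv horth
  have hsummable := (hon.inner_products_summable (x := x)).mul_left m
  simp only [← norm_inner_sq_eq_mul hm] at hsummable
  rw [tsum_enorm_sq hsummable]
  simp only [norm_inner_sq_eq_mul (𝕜 := 𝕜) hm (v _), tsum_mul_left]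
  gcongr
  exact hon.tsum_inner_products_le x

lemma tsum_enorm_inner_sq_eq [CompleteSpace E] (hm : 0 < m) (hv : ∀ j, ‖v j‖ ^ 2 = m)
    (horth : Pairwise fun i j => inner 𝕜 (v i) (v j) = 0)
    (hspan : (Submodule.span 𝕜 (Set.range v)).topologicalClosure = ⊤) (x : E) :
    ∑' j, ‖inner 𝕜 (v j) x‖ₑ ^ 2 = ENNReal.ofReal (m * ‖x‖ ^ 2) := by
  have hon := orthonormal_inv_sqrt_smul hm hv horth
  have hspan' : Submodule.span 𝕜 (Set.range fun j => ((√m : ℝ) : 𝕜)⁻¹ • v j) =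
      Submodule.span 𝕜 (Set.range v) := by
    have hunit : IsUnit ((√m : ℝ) : 𝕜)⁻¹ := by
      simpa using Real.sqrt_ne_zero'.2 hm
    rw [← Submodule.span_smul_eq_of_isUnit (Set.range v) _ hunit, ← Set.image_smul,
      ← Set.range_comp]
    rfl
  let b := HilbertBasis.mk hon (by rw [hspan', hspan])
  have hb (j : J) : b j = ((√m : ℝ) : 𝕜)⁻¹ • v j := by simp [b]
  have hsum : HasSum (fun j => ‖inner 𝕜 (b j) x‖ ^ 2) (‖x‖ ^ 2) := by
    simpa [b.repr_apply_apply] using lp.hasSum_norm (p := 2) (by simp) (b.repr x)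
  simp only [hb] at hsum
  have := hsum.mul_left m
  simp only [← norm_inner_sq_eq_mul hm] at this
  rw [tsum_enorm_sq this.summable, this.tsum_eq]

end OrthogonalFamilies

section Bessel

lemma enorm_circle_coe (z : Circle) : ‖(z : ℂ)‖ₑ = 1 := by
  rw [← ofReal_norm, Circle.norm_coe, ENNReal.ofReal_one]

lemma inner_toLp_toLp {G : Type*} [MeasurableSpace G] {ν : Measure G} {f g : G → ℂ}
    (hf : MemLp f 2 ν) (hg : MemLp g 2 ν) :
    inner ℂ (hf.toLp f) (hg.toLp g) = ∫ x, g x * (starRingEnd ℂ) (f x) ∂ν := by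
  rw [L2.inner_def]
  refine integral_congr_ae ?_
  filter_upwards [hf.coeFn_toLp, hg.coeFn_toLp] with x hfx hgx
  rw [hfx, hgx]
  rfl

lemma coe_addChar_sub_apply {G : Type*} [AddCommGroup G] (χ ψ : AddChar G Circle) (x : G) :
    ((χ - ψ) x : ℂ) = χ x * (starRingEnd ℂ) (ψ x : ℂ) := by
  rw [AddChar.sub_apply, AddChar.map_neg_eq_inv, Circle.coe_mul, Circle.coe_inv_eq_conj]

variable {G : Type*} [AddCommGroup G] [TopologicalSpace G] [MeasurableSpace G]
  [OpensMeasurableSpace G] {χ ψ : AddChar G Circle} {P Q : Set G}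

lemma memLp_indicator_addChar (ν : Measure G) [IsFiniteMeasure ν] (hχ : Continuous χ)
    (hQ : MeasurableSet Q) : MemLp (Q.indicator fun x => (χ x : ℂ)) 2 ν :=
  (MemLp.of_bound (continuous_subtype_val.comp hχ).aestronglyMeasurable 1
    (ae_of_all _ fun x => (Circle.norm_coe (χ x)).le)).indicator hQ

/-- The restriction to `Q` of the continuous character `χ`, as an element of `L²(ν)`. -/
noncomputable def charLp (ν : Measure G) [IsFiniteMeasure ν] (hχ : Continuous χ)
    (hQ : MeasurableSet Q) : Lp ℂ 2 ν :=
  (memLp_indicator_addChar ν hχ hQ).toLp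

variable {ν : Measure G} [IsFiniteMeasure ν]

lemma charLp_univ_ae_eq (hχ : Continuous χ) : charLp ν hχ .univ =ᵐ[ν] fun x => (χ x : ℂ) :=
  (memLp_indicator_addChar ν hχ .univ).coeFn_toLp.trans (by rw [Set.indicator_univ])

lemma inner_charLp (hχ : Continuous χ) (hψ : Continuous ψ) (hP : MeasurableSet P)
    (hQ : MeasurableSet Q) :
    inner ℂ (charLp ν hχ hP) (charLp ν hψ hQ) = ∫ x in P ∩ Q, ((ψ - χ) x : ℂ) ∂ν := by
  rw [charLp, charLp, inner_toLp_toLp, ← integral_indicator (hP.inter hQ)]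
  congr with x
  by_cases hxP : x ∈ P <;> by_cases hxQ : x ∈ Q <;> simp [hxP, hxQ, coe_addChar_sub_apply]

lemma norm_charLp_sq (hχ : Continuous χ) (hQ : MeasurableSet Q) :
    ‖charLp ν hχ hQ‖ ^ 2 = ν.real Q := by
  rw [← Complex.ofReal_inj, Complex.ofReal_pow, ← Complex.coe_algebraMap,
    ← inner_self_eq_norm_sq_to_K (𝕜 := ℂ), inner_charLp]
  simp

lemma tsum_enorm_setIntegral_sub_sq_le {J : Type*} {χ : J → AddChar G Circle}
    (hχ : ∀ j, Continuous (χ j))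
    (horth : Pairwise fun i j => ∫ x, ((χ i - χ j) x : ℂ) ∂ν = 0) (hψ : Continuous ψ)
    (hQ : MeasurableSet Q) :
    ∑' j, ‖∫ x in Q, ((ψ - χ j) x : ℂ) ∂ν‖ₑ ^ 2 ≤ ν Set.univ * ν Q := by
  rcases eq_zero_or_neZero ν with rfl | _
  · simp
  have hbessel := tsum_enorm_inner_sq_le (𝕜 := ℂ) (v := fun j => charLp ν (hχ j) .univ)
    measureReal_univ_pos (fun j => norm_charLp_sq _ _)
    (fun i j hij => by simpa [inner_charLp] using horth hij.symm) (charLp ν hψ hQ)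
  simpa [inner_charLp, norm_charLp_sq, ENNReal.ofReal_mul] using hbessel

lemma IsSpectrum.tsum_enorm_setIntegral_sub_sq {μ : Measure G} {Ω : Set G}
    {Λ : Set (AddChar G Circle)} (h : IsSpectrum μ Ω Λ) (hΩ : μ Ω ≠ ⊤) (hψ : Continuous ψ)
    (hQ : MeasurableSet Q) (hQΩ : Q ⊆ Ω) :
    ∑' χ : Λ, ‖∫ x in Q, ((ψ - χ) x : ℂ) ∂μ‖ₑ ^ 2 = μ Ω * μ Q := by
  have : IsFiniteMeasure (μ.restrict Ω) := ⟨by simpa using hΩ.lt_top⟩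
  rw [← Measure.restrict_apply_univ Ω, ← Measure.restrict_eq_self μ hQΩ,
    ← Measure.restrict_restrict_of_subset hQΩ]
  rcases eq_zero_or_neZero (μ.restrict Ω) with h0 | _
  · simp [h0]
  have horth : Pairwise fun χ χ' : Λ => inner ℂ (charLp (μ.restrict Ω) (h.continuous χ χ.2) .univ)
      (charLp (μ.restrict Ω) (h.continuous χ' χ'.2) .univ) = 0 := by
    intro χ χ' hne
    simpa [inner_charLp, coe_addChar_sub_apply] using
      h.orthogonal χ' χ'.2 χ χ.2 (Subtype.coe_ne_coe.2 hne.symm)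
  have hparseval := tsum_enorm_inner_sq_eq measureReal_univ_pos (fun _ => norm_charLp_sq _ _)
    horth ?_ (charLp (μ.restrict Ω) hψ hQ)
  · simpa [inner_charLp, norm_charLp_sq, ENNReal.ofReal_mul, ofReal_measureReal hΩ] using hparseval
  rw [← h.complete]
  congr 2
  ext f
  constructor
  · rintro ⟨χ, rfl⟩
    exact ⟨χ, χ.2, charLp_univ_ae_eq _⟩
  · rintro ⟨χ, hχ, hf⟩
    exact ⟨⟨χ, hχ⟩, (Lp.ext (hf.trans (charLp_univ_ae_eq _).symm)).symm⟩

end Bessel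

section DiscreteGroups

variable {G : Type*} [MeasurableSpace G] [MeasurableSingletonClass G] {A : Finset G}

lemma setIntegral_count_finset (f : G → ℂ) :
    ∫ x in (A : Set G), f x ∂Measure.count = ∑ x ∈ A, f x := by
  have : IsFiniteMeasure (Measure.count.restrict (A : Set G)) := ⟨by simp⟩
  have hint : IntegrableOn f A (Measure.count.restrict (A : Set G)) := .finset
  rw [IntegrableOn, Measure.restrict_restrict A.measurableSet, Set.inter_self] at hint
  rw [setIntegral_finset _ hint]
  simp [Measure.real]

theorem HasFewOrthogonalCharacters.not_isSpectral_count [AddCommGroup G] [TopologicalSpace G]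
    [OpensMeasurableSpace G] (hA : HasFewOrthogonalCharacters A) :
    ¬ IsSpectral Measure.count (A : Set G) := by
  rintro ⟨Λ, hΛ⟩
  obtain ⟨a, ha⟩ := hA.nonempty
  have hparseval := hΛ.tsum_enorm_setIntegral_sub_sq (by simp) (ψ := 0)
    continuous_const (measurableSet_singleton a) (by simpa using ha)
  have hone (χ : AddChar G Circle) :
      ‖∫ x in {a}, ((0 - χ) x : ℂ) ∂Measure.count‖ₑ ^ 2 = 1 := by
    simp [enorm_circle_coe]
  have hΛcard : Λ.encard = #A := by
    simp only [hone, ENNReal.tsum_set_one, Measure.count_singleton, mul_one,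
      Measure.count_apply_finset] at hparseval
    exact_mod_cast hparseval
  have hfin : Λ.Finite := Set.finite_of_encard_eq_coe hΛcard
  refine (hA hfin.toFinset ?_).ne ?_
  · rw [hfin.coe_toFinset]
    intro χ hχ ψ hψ hne
    rw [charSum, ← hΛ.orthogonal χ hχ ψ hψ hne, setIntegral_count_finset]
    simp only [coe_addChar_sub_apply]
  · rw [hfin.encard_eq_coe_toFinset_card] at hΛcard
    exact_mod_cast hΛcard

end DiscreteGroups

section CharactersOfVectorSpaces

open scoped FourierTransform

/-- The character lifts through the covering `exp : ℝ → Circle`, and the lift is additive because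
lifts are unique. -/
lemma exists_eq_fourierChar_of_continuous {V : Type*} [AddCommGroup V] [Module ℝ V]
    [TopologicalSpace V] [IsTopologicalAddGroup V] [ContinuousSMul ℝ V] [LocallyConvexSpace ℝ V]
    {χ : AddChar V Circle} (hχ : Continuous χ) : ∃ f : V →L[ℝ] ℝ, ∀ x, χ x = 𝐞 (f x) := by
  obtain ⟨F, ⟨hF0, hF⟩, -⟩ := Circle.isCoveringMap_exp.existsUnique_continuousMap_lifts
    ⟨χ, hχ⟩ 0 0 (by simp)
  have hF (x : V) : Circle.exp (F x) = χ x := congrFun hF x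
  have hadd (x y : V) : F (x + y) = F x + F y := by
    refine congrFun (Circle.isCoveringMap_exp.eq_of_comp_eq (g₁ := fun x => F (x + y))
      (g₂ := fun x => F x + F y) (by fun_prop) (by fun_prop) ?_ 0 (by simp [hF0])) x
    ext z
    simp [hF, Circle.exp_add, AddChar.map_add_eq_mul]
  let f : V →+ ℝ := { toFun := F, map_zero' := hF0, map_add' := hadd }
  refine ⟨(2 * Real.pi)⁻¹ • f.toRealLinearMap F.continuous, fun x => ?_⟩
  rw [Real.fourierChar_apply', ← hF]
  congr 1
  simp only [f, smul_apply, AddMonoidHom.coe_toRealLinearMap,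
    AddMonoidHom.coe_mk, ZeroHom.coe_mk, smul_eq_mul]
  field_simp

lemma exists_eq_dotChar_of_continuous {ι : Type*} [Fintype ι] {χ : AddChar (ι → ℝ) Circle}
    (hχ : Continuous χ) : ∃ θ, χ = dotChar 𝐞 θ := by
  classical
  obtain ⟨f, hf⟩ := exists_eq_fourierChar_of_continuous hχ
  refine ⟨(dotProductEquiv ℝ ι).symm f, ?_⟩
  ext x
  rw [hf, dotChar_apply, ← dotProductEquiv_apply_apply, LinearEquiv.apply_symm_apply,
    ContinuousLinearMap.coe_coe]

end CharactersOfVectorSpaces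

section IntegralsOverTranslates

open Pointwise

variable {G : Type*} [AddCommGroup G] [TopologicalSpace G] [MeasurableSpace G] [BorelSpace G]
  [IsTopologicalAddGroup G] {μ : Measure G} [μ.IsAddLeftInvariant] {C : Set G}
  {χ : AddChar G Circle}

lemma setIntegral_vadd_addChar (v : G) :
    ∫ x in v +ᵥ C, (χ x : ℂ) ∂μ = χ v * ∫ x in C, (χ x : ℂ) ∂μ := by
  have hemb := (Homeomorph.addLeft v).measurableEmbedding
  rw [← Set.image_vadd]
  change ∫ x in (v + ·) '' C, _ ∂μ = _
  rw [(measurePreserving_add_left μ v).setIntegral_image_emb hemb, ← integral_const_mul]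
  simp only [AddChar.map_add_eq_mul, Circle.coe_mul]

lemma setIntegral_biUnion_vadd_addChar {H : Type*} [AddCommGroup H] {f : H →+ G} {A : Finset H}
    (hdisj : (A : Set H).PairwiseDisjoint fun a => f a +ᵥ C) (hC : MeasurableSet C)
    (hμC : μ C ≠ ⊤) (hχ : Continuous χ) :
    ∫ x in ⋃ a ∈ A, f a +ᵥ C, (χ x : ℂ) ∂μ =
      charSum A (charPullback f χ) * ∫ x in C, (χ x : ℂ) ∂μ := by
  rw [integral_biUnion_finset _ (fun a _ => hC.const_vadd _) hdisj, charSum, sum_mul]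
  · exact sum_congr rfl fun a _ => setIntegral_vadd_addChar _
  · intro a _
    exact Measure.integrableOn_of_bounded (M := 1) (by rwa [measure_vadd])
      (continuous_subtype_val.comp hχ).aestronglyMeasurable
      (ae_of_all _ fun x => (Circle.norm_coe _).le)

end IntegralsOverTranslates

section UnitCubes

open Pointwise
open scoped FourierTransform

variable {ι : Type*} {d : ℕ} {A : Finset (Fin d → ℤ)}

/-- The half-open unit cube in `ℝ^ι`. -/
def unitCube (ι : Type*) : Set (ι → ℝ) :=
  Set.univ.pi fun _ => Set.Ico 0 1

lemma mem_latticeInclusion_vadd_unitCube {a : ι → ℤ} {x : ι → ℝ} :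
    x ∈ latticeInclusion ι a +ᵥ unitCube ι ↔ (fun i => ⌊x i⌋) = a := by
  simp only [Set.mem_vadd_set_iff_neg_vadd_mem, unitCube, Set.mem_univ_pi, vadd_eq_add,
    neg_add_eq_sub, Pi.sub_apply, latticeInclusion_apply, Set.mem_Ico, funext_iff,
    Int.floor_eq_iff, sub_nonneg, sub_lt_iff_lt_add']

lemma pairwiseDisjoint_latticeInclusion_vadd_unitCube (A : Set (ι → ℤ)) :
    A.PairwiseDisjoint fun a => latticeInclusion ι a +ᵥ unitCube ι := by
  refine fun a _ b _ hab => Set.disjoint_left.2 fun x ha hb => hab ?_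
  rw [← mem_latticeInclusion_vadd_unitCube.1 ha, mem_latticeInclusion_vadd_unitCube.1 hb]

lemma unionOfUnitCubes_eq_biUnion_vadd :
    unionOfUnitCubes A = ⋃ a ∈ A, latticeInclusion (Fin d) a +ᵥ unitCube (Fin d) := by
  simp only [unionOfUnitCubes, ← Int.floor_eq_iff, Set.mem_Ico, Set.ext_iff, Set.mem_iUnion,
    mem_latticeInclusion_vadd_unitCube, funext_iff, Set.mem_ofPred_eq, implies_true]

lemma mem_unionOfUnitCubes {x : Fin d → ℝ} :
    x ∈ unionOfUnitCubes A ↔ (fun i => ⌊x i⌋) ∈ A := by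
  simp [unionOfUnitCubes_eq_biUnion_vadd, mem_latticeInclusion_vadd_unitCube]

lemma measurableSet_unitCube [Finite ι] : MeasurableSet (unitCube ι) :=
  .univ_pi fun _ => measurableSet_Ico

variable [Fintype ι]

lemma volume_unitCube : volume (unitCube ι) = 1 := by
  simp [unitCube, volume_pi_pi]

lemma volume_unionOfUnitCubes : volume (unionOfUnitCubes A) = #A := by
  rw [unionOfUnitCubes_eq_biUnion_vadd, measure_biUnion_finset
    (pairwiseDisjoint_latticeInclusion_vadd_unitCube _)
    fun a _ => measurableSet_unitCube.const_vadd _]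
  simp [measure_vadd, volume_unitCube]

lemma continuous_uncurry_dotChar_fourierChar :
    Continuous (Function.uncurry fun θ x : ι → ℝ => dotChar 𝐞 θ x) := by
  simp only [dotChar_apply]
  exact Real.continuous_fourierChar.comp (continuous_fst.dotProduct continuous_snd)

lemma continuous_dotChar_fourierChar (θ : ι → ℝ) : Continuous (dotChar 𝐞 θ) :=
  continuous_uncurry_dotChar_fourierChar.uncurry_left θ

/-- The Fourier transform of the indicator function of the unit cube, with the sign convention
`x ↦ exp (2πi θ · x)` for the character of frequency `θ`. -/
noncomputable def cubeTransform (θ : ι → ℝ) : ℂ :=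
  ∫ x in unitCube ι, (dotChar 𝐞 θ x : ℂ)

lemma measurable_cubeTransform : Measurable (cubeTransform : (ι → ℝ) → ℂ) :=
  (StronglyMeasurable.integral_prod_right (f := fun θ x => (dotChar 𝐞 θ x : ℂ))
    (continuous_subtype_val.comp
      continuous_uncurry_dotChar_fourierChar).stronglyMeasurable).measurable

lemma setIntegral_unionOfUnitCubes_dotChar (θ : Fin d → ℝ) :
    ∫ x in unionOfUnitCubes A, (dotChar 𝐞 θ x : ℂ) =
      charSum A (latticeChar θ) * cubeTransform θ := by
  rw [unionOfUnitCubes_eq_biUnion_vadd, setIntegral_biUnion_vadd_addChar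
    (pairwiseDisjoint_latticeInclusion_vadd_unitCube _) measurableSet_unitCube
    (by simp [volume_unitCube]) (continuous_dotChar_fourierChar θ)]
  rfl

lemma integral_Ico_fourierChar_eq_zero_iff {t : ℝ} :
    ∫ x in Set.Ico (0 : ℝ) 1, (𝐞 (t * x) : ℂ) = 0 ↔ ∃ m : ℤ, m ≠ 0 ∧ t = m := by
  rcases eq_or_ne t 0 with rfl | ht
  · simp [eq_comm]
  have hc : (2 * Real.pi * t * Complex.I : ℂ) ≠ 0 := by simp [Real.pi_ne_zero, ht]
  have hexp (x : ℝ) : (𝐞 (t * x) : ℂ) = Complex.exp (2 * Real.pi * t * Complex.I * x) := by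
    rw [Real.fourierChar_apply]
    push_cast
    ring_nf
  have hint : ∫ x in Set.Ico (0 : ℝ) 1, (𝐞 (t * x) : ℂ) =
      (𝐞 t - 1) / (2 * Real.pi * t * Complex.I) := by
    rw [integral_Ico_eq_integral_Ioc, ← intervalIntegral.integral_of_le zero_le_one]
    simp only [hexp]
    rw [integral_exp_mul_complex hc, ← hexp, ← hexp]
    simp
  rw [hint, div_eq_zero_iff, or_iff_left hc, sub_eq_zero, Circle.coe_eq_one, fourierChar_eq_one_iff]
  refine exists_congr fun m => (and_iff_right_of_imp ?_).symm
  rintro rfl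
  exact_mod_cast ht

lemma cubeTransform_eq_prod (θ : ι → ℝ) :
    cubeTransform θ = ∏ i, ∫ t in Set.Ico (0 : ℝ) 1, (𝐞 (θ i * t) : ℂ) := by
  classical
  rw [cubeTransform, unitCube, volume_pi, Measure.restrict_pi_pi, ← integral_fintype_prod_eq_prod]
  refine integral_congr_ae (ae_of_all _ fun x => ?_)
  beta_reduce
  rw [addChar_eq_prod_single]
  simp only [dotChar_apply, dotProduct_single]
  exact map_prod Circle.coeHom _ _

lemma cubeTransform_eq_zero_iff {θ : ι → ℝ} :
    cubeTransform θ = 0 ↔ ∃ i, ∃ m : ℤ, m ≠ 0 ∧ θ i = m := by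
  simp [cubeTransform_eq_prod, prod_eq_zero_iff, integral_Ico_fourierChar_eq_zero_iff]

end UnitCubes

section Averaging

lemma tsum_indicator_one_eq_one {J V : Type*} {f : J → V} {C : Set V} (h : ∃! j, f j ∈ C) :
    ∑' j, C.indicator (fun _ => (1 : ENNReal)) (f j) = 1 := by
  obtain ⟨j, hj, huniq⟩ := h
  rw [tsum_eq_single j fun k hk => Set.indicator_of_notMem (mt (huniq k) hk) _,
    Set.indicator_of_mem hj]

lemma setLIntegral_tsum_sub {V J : Type*} [AddGroup V] [MeasurableSpace V] [MeasurableAdd V]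
    {μ : Measure V} [μ.IsAddRightInvariant] [Countable J] (θ : J → V) {g : V → ENNReal}
    (hg : Measurable g) {C : Set V} (hC : MeasurableSet C) :
    ∫⁻ ξ in C, ∑' j, g (ξ - θ j) ∂μ =
      ∫⁻ η, g η * ∑' j, C.indicator (fun _ => (1 : ENNReal)) (η + θ j) ∂μ := by
  have hsub (j : J) : Measurable fun ξ => g (ξ - θ j) := by
    simp only [sub_eq_add_neg]
    exact hg.comp (measurable_add_const (-θ j))
  have hind (j : J) : Measurable fun η => C.indicator (fun _ => (1 : ENNReal)) (η + θ j) :=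
    (measurable_const.indicator hC).comp (measurable_add_const (θ j))
  simp only [← ENNReal.tsum_mul_left]
  rw [lintegral_tsum fun j => (hsub j).aemeasurable,
    lintegral_tsum fun j => (hg.fun_mul (hind j)).aemeasurable]
  refine tsum_congr fun j => ?_
  rw [← lintegral_indicator hC, ← lintegral_add_right_eq_self _ (θ j)]
  refine lintegral_congr fun η => ?_
  by_cases hη : η + θ j ∈ C <;> simp [hη]

end Averaging

section Spectra

open Pointwise
open scoped FourierTransform

section

variable {ι : Type*}

lemma existsUnique_add_latticeInclusion_mem_unitCube (η : ι → ℝ) :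
    ∃! m, η + latticeInclusion ι m ∈ unitCube ι := by
  have hmem (m : ι → ℤ) : η + latticeInclusion ι m ∈ unitCube ι ↔ m = -fun i => ⌊η i⌋ := by
    rw [← neg_eq_iff_eq_neg, eq_comm, ← mem_latticeInclusion_vadd_unitCube,
      Set.mem_vadd_set_iff_neg_vadd_mem, map_neg, neg_neg, vadd_eq_add, add_comm]
  simp only [hmem, existsUnique_eq]

lemma countable_of_tsum_indicator_unitCube_ne_top [Finite ι] {J : Type*} {θ : J → ι → ℝ}
    (h : ∀ η, ∑' j, (unitCube ι).indicator (fun _ => (1 : ENNReal)) (η + θ j) ≠ ⊤) :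
    Countable J := by
  rw [← Set.countable_univ_iff]
  refine (Set.countable_iUnion fun m : ι → ℤ =>
    Summable.countable_support_ennreal (h (latticeInclusion ι m))).mono fun j _ => ?_
  obtain ⟨m, hm, -⟩ := existsUnique_add_latticeInclusion_mem_unitCube (θ j)
  rw [add_comm] at hm
  exact Set.mem_iUnion.2 ⟨m, by simp [hm]⟩

variable [Fintype ι]

lemma cubeTransform_latticeInclusion_eq_zero {m : ι → ℤ} (hm : m ≠ 0) :
    cubeTransform (latticeInclusion ι m) = 0 := by
  obtain ⟨i, hi⟩ := Function.ne_iff.1 hm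
  exact cubeTransform_eq_zero_iff.2 ⟨i, m i, hi, rfl⟩

lemma cubeTransform_sub (θ θ' : ι → ℝ) :
    cubeTransform (θ - θ') = ∫ x in unitCube ι, ((dotChar 𝐞 θ - dotChar 𝐞 θ') x : ℂ) := by
  rw [cubeTransform, map_sub]

lemma lintegral_enorm_cubeTransform_sq_le : ∫⁻ η : ι → ℝ, ‖cubeTransform η‖ₑ ^ 2 ≤ 1 := by
  have : IsFiniteMeasure (volume.restrict (unitCube ι)) := ⟨by simp [volume_unitCube]⟩
  have hbessel (ξ : ι → ℝ) : ∑' m : ι → ℤ, ‖cubeTransform (ξ - latticeInclusion ι m)‖ₑ ^ 2 ≤ 1 := by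
    have := tsum_enorm_setIntegral_sub_sq_le (ν := volume.restrict (unitCube ι))
      (fun m : ι → ℤ => continuous_dotChar_fourierChar (latticeInclusion ι m)) (fun m m' hm => ?_)
      (continuous_dotChar_fourierChar ξ) .univ
    · simpa [← cubeTransform_sub, volume_unitCube] using this
    · beta_reduce
      rw [← cubeTransform_sub, ← map_sub, cubeTransform_latticeInclusion_eq_zero (sub_ne_zero.2 hm)]
  have haverage := setLIntegral_tsum_sub (μ := volume) (latticeInclusion ι)
    (measurable_cubeTransform.enorm.pow_const 2) measurableSet_unitCube
  simp only [tsum_indicator_one_eq_one (existsUnique_add_latticeInclusion_mem_unitCube _),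
    mul_one] at haverage
  calc ∫⁻ η : ι → ℝ, ‖cubeTransform η‖ₑ ^ 2
      = ∫⁻ ξ in unitCube ι, ∑' m, ‖cubeTransform (ξ - latticeInclusion ι m)‖ₑ ^ 2 := haverage.symm
    _ ≤ ∫⁻ _ in unitCube ι, 1 := lintegral_mono hbessel
    _ = 1 := by rw [setLIntegral_one, volume_unitCube]

end

variable {d : ℕ} {A : Finset (Fin d → ℤ)} {J : Type*} {θ : J → Fin d → ℝ}

/-- The differences of the frequencies in a unit cube lie in `(-1,1)^d`, where the transform of the
cube does not vanish. -/
lemma HasFewOrthogonalCharacters.tsum_indicator_unitCube_le (hA : HasFewOrthogonalCharacters A)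
    (hθ : Pairwise fun i j => ∫ x in unionOfUnitCubes A, (dotChar 𝐞 (θ i - θ j) x : ℂ) = 0)
    (η : Fin d → ℝ) :
    ∑' j, (unitCube (Fin d)).indicator (fun _ => (1 : ENNReal)) (η + θ j) ≤ (#A - 1 : ℕ) := by
  classical
  rw [ENNReal.tsum_eq_iSup_sum]
  refine iSup_le fun s => ?_
  let t := {j ∈ s | η + θ j ∈ unitCube (Fin d)}
  have hsum : ∑ j ∈ s, (unitCube (Fin d)).indicator (fun _ => (1 : ENNReal)) (η + θ j) = #t := by
    simp [t, Set.indicator_apply]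
  have ht : #t < #A := by
    refine hA.card_lt_of_pairwise (χ := fun j => latticeChar (θ j)) fun i hi j hj hij => ?_
    have hprod : ∫ x in unionOfUnitCubes A, (dotChar 𝐞 (θ i - θ j) x : ℂ) = 0 := hθ hij
    rw [setIntegral_unionOfUnitCubes_dotChar, mul_eq_zero, map_sub] at hprod
    refine hprod.resolve_right fun hzero => ?_
    obtain ⟨k, m, hm, hkm⟩ := cubeTransform_eq_zero_iff.1 hzero
    have hi := (mem_filter.1 hi).2 k trivial
    have hj := (mem_filter.1 hj).2 k trivial
    simp only [Pi.add_apply, Pi.sub_apply, Set.mem_Ico] at hi hj hkm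
    refine hm (Int.abs_lt_one_iff.1 ?_)
    rw [← @Int.cast_lt ℝ, Int.cast_abs, Int.cast_one, ← hkm, abs_lt]
    constructor <;> linarith
  rw [hsum]
  exact_mod_cast Nat.le_sub_one_of_lt ht

lemma IsSpectrum.tsum_enorm_cubeTransform_sq {Λ : Set (AddChar (Fin d → ℝ) Circle)}
    (h : IsSpectrum volume (unionOfUnitCubes A) Λ) (hA : A.Nonempty) {θ : Λ → Fin d → ℝ}
    (hθ : ∀ χ : Λ, χ = dotChar 𝐞 (θ χ)) (ξ : Fin d → ℝ) :
    ∑' χ, ‖cubeTransform (ξ - θ χ)‖ₑ ^ 2 = #A := by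
  obtain ⟨a, ha⟩ := hA
  have hsub : latticeInclusion (Fin d) a +ᵥ unitCube (Fin d) ⊆ unionOfUnitCubes A := by
    rw [unionOfUnitCubes_eq_biUnion_vadd]
    exact Set.subset_biUnion_of_mem
      (u := fun a => latticeInclusion (Fin d) a +ᵥ unitCube (Fin d)) ha
  have hparseval := h.tsum_enorm_setIntegral_sub_sq (by simp [volume_unionOfUnitCubes])
    (continuous_dotChar_fourierChar ξ) (measurableSet_unitCube.const_vadd _) hsub
  rw [measure_vadd, volume_unitCube, mul_one, volume_unionOfUnitCubes] at hparseval
  rw [← hparseval]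
  refine tsum_congr fun χ => ?_
  rw [setIntegral_vadd_addChar, enorm_mul, enorm_circle_coe, one_mul, cubeTransform_sub, ← hθ]

theorem HasFewOrthogonalCharacters.not_isSpectral_unionOfUnitCubes
    (hA : HasFewOrthogonalCharacters A) : ¬ IsSpectral volume (unionOfUnitCubes A) := by
  rintro ⟨Λ, hΛ⟩
  choose θ hθ using fun χ : Λ => exists_eq_dotChar_of_continuous (hΛ.continuous χ χ.2)
  have horth : Pairwise fun χ ψ : Λ =>
      ∫ x in unionOfUnitCubes A, (dotChar 𝐞 (θ χ - θ ψ) x : ℂ) = 0 := by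
    intro χ ψ hne
    simp only [map_sub, ← hθ, coe_addChar_sub_apply]
    exact hΛ.orthogonal χ χ.2 ψ ψ.2 (Subtype.coe_ne_coe.2 hne)
  have hcount := hA.tsum_indicator_unitCube_le horth
  have : Countable Λ := countable_of_tsum_indicator_unitCube_ne_top fun η =>
    ((hcount η).trans_lt (ENNReal.natCast_lt_top _)).ne
  have haverage := setLIntegral_tsum_sub (μ := volume) θ
    (measurable_cubeTransform.enorm.pow_const 2) measurableSet_unitCube
  have hle : (#A : ENNReal) ≤ (#A - 1 : ℕ) := calc
    (#A : ENNReal) = ∫⁻ ξ in unitCube (Fin d), ∑' χ, ‖cubeTransform (ξ - θ χ)‖ₑ ^ 2 := by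
      simp only [hΛ.tsum_enorm_cubeTransform_sq hA.nonempty hθ]
      rw [setLIntegral_const, volume_unitCube, mul_one]
    _ = ∫⁻ η, ‖cubeTransform η‖ₑ ^ 2 *
        ∑' χ, (unitCube (Fin d)).indicator (fun _ => (1 : ENNReal)) (η + θ χ) := haverage
    _ ≤ ∫⁻ η : Fin d → ℝ, ‖cubeTransform η‖ₑ ^ 2 * (#A - 1 : ℕ) := by
      gcongr
      exact hcount _
    _ ≤ (#A - 1 : ℕ) := by
      rw [lintegral_mul_const _ (measurable_cubeTransform.enorm.pow_const 2)]
      exact mul_le_of_le_one_left zero_le lintegral_enorm_cubeTransform_sq_le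
  exact (Nat.sub_lt hA.nonempty.card_pos one_pos).not_ge (by exact_mod_cast hle)

end Spectra

section Tilings

variable {G : Type*} [AddCommGroup G] [MeasurableSpace G] {μ : Measure G} {Ω Ω' T : Set G}

lemma isTilingComplement_of_isComplement (h : AddSubgroup.IsComplement Ω T) :
    IsTilingComplement μ Ω T := by
  rw [AddSubgroup.isComplement_iff_existsUnique_add_neg_mem] at h
  refine ae_of_all _ fun x => tsum_indicator_one_eq_one ?_
  simpa only [sub_eq_add_neg] using h x

lemma IsTilingComplement.congr_ae [MeasurableAdd G] [μ.IsAddRightInvariant] [Countable T]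
    (h : IsTilingComplement μ Ω T) (hΩ : Ω =ᵐ[μ] Ω') : IsTilingComplement μ Ω' T := by
  have hsub : ∀ᵐ x ∂μ, ∀ t : T, x - (t : G) ∈ Ω ↔ x - (t : G) ∈ Ω' :=
    ae_all_iff.2 fun t =>
      (measurePreserving_sub_right μ (t : G)).quasiMeasurePreserving.ae hΩ.mem_iff
  filter_upwards [h, hsub] with x hx hxΩ
  refine (tsum_congr fun t => ?_).trans hx
  by_cases ht : x - (t : G) ∈ Ω
  · rw [Set.indicator_of_mem ht, Set.indicator_of_mem ((hxΩ t).1 ht)]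
  · rw [Set.indicator_of_notMem ht, Set.indicator_of_notMem (mt (hxΩ t).2 ht)]

lemma IsSpectrum.congr_ae [TopologicalSpace G] {Λ : Set (AddChar G Circle)}
    (h : IsSpectrum μ Ω Λ) (hΩ : Ω =ᵐ[μ] Ω') : IsSpectrum μ Ω' Λ := by
  have hrestrict := Measure.restrict_congr_set hΩ
  exact ⟨h.continuous, hrestrict ▸ h.orthogonal, hrestrict ▸ h.complete⟩

end Tilings

section InteriorOfCubes

open Pointwise

variable {d : ℕ} {A : Finset (Fin d → ℤ)}

lemma isComplement_unionOfUnitCubes {T : Set (Fin d → ℤ)}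
    (h : AddSubgroup.IsComplement (A : Set (Fin d → ℤ)) T) :
    AddSubgroup.IsComplement (unionOfUnitCubes A) (latticeInclusion (Fin d) '' T) := by
  rw [AddSubgroup.isComplement_iff_existsUnique_add_neg_mem] at h ⊢
  intro x
  have hmem (t : Fin d → ℤ) : x + -latticeInclusion (Fin d) t ∈ unionOfUnitCubes A ↔
      (fun i => ⌊x i⌋) + -t ∈ (A : Set (Fin d → ℤ)) := by
    rw [← sub_eq_add_neg, ← sub_eq_add_neg, mem_unionOfUnitCubes, mem_coe]
    simp only [Pi.sub_apply, latticeInclusion_apply, Int.floor_sub_intCast]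
    rfl
  obtain ⟨⟨t, htT⟩, ht, huniq⟩ := h fun i => ⌊x i⌋
  refine ⟨⟨_, Set.mem_image_of_mem _ htT⟩, (hmem t).2 ht, ?_⟩
  rintro ⟨_, s, hsT, rfl⟩ hs
  obtain rfl : s = t := congrArg Subtype.val (huniq ⟨s, hsT⟩ ((hmem s).1 hs))
  rfl

lemma measure_frontier_biUnion_eq_zero {X κ : Type*} [TopologicalSpace X] [MeasurableSpace X]
    {μ : Measure X} {s : Finset κ} {f : κ → Set X} (h : ∀ k ∈ s, μ (frontier (f k)) = 0) :
    μ (frontier (⋃ k ∈ s, f k)) = 0 := by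
  classical
  induction s using Finset.induction_on with
  | empty => simp
  | insert k s _ ih =>
    rw [set_biUnion_insert]
    refine measure_mono_null ((frontier_union_subset _ _).trans
      (Set.union_subset_union Set.inter_subset_left Set.inter_subset_right)) ?_
    exact measure_union_null (h k (mem_insert_self k s)) (ih fun l hl => h l (mem_insert_of_mem hl))

lemma interior_unionOfUnitCubes_ae_eq :
    interior (unionOfUnitCubes A) =ᵐ[volume] unionOfUnitCubes A := by
  refine interior_ae_eq_of_null_frontier ?_
  rw [unionOfUnitCubes_eq_biUnion_vadd]
  refine measure_frontier_biUnion_eq_zero fun a _ => Convex.addHaar_frontier _ (.vadd ?_ _)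
  exact convex_pi fun _ _ => convex_Ico 0 1

end InteriorOfCubes

theorem theorem4p3 (d : ℕ) (hd : 5 ≤ d) :
    ∃ A : Finset (Fin d → ℤ),
      (TilesByTranslation Measure.count (A : Set (Fin d → ℤ)) ∧
        ¬ IsSpectral Measure.count (A : Set (Fin d → ℤ))) ∧
      (TilesByTranslation volume (unionOfUnitCubes A) ∧
        ¬ IsSpectral volume (unionOfUnitCubes A)) ∧
      (TilesByTranslation volume (interior (unionOfUnitCubes A)) ∧
        ¬ IsSpectral volume (interior (unionOfUnitCubes A))) := by
  obtain ⟨N, hN, B, S, hB, hBS⟩ := exists_hasFewOrthogonalCharacters_isComplement hd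
  have : NeZero N := ⟨hN⟩
  obtain ⟨n, hn, hA⟩ := exists_hasFewOrthogonalCharacters_liftBox hB
  obtain ⟨T, hT⟩ := exists_isComplement_liftBox hn hBS
  have : Countable (latticeInclusion (Fin d) '' T) := (T.to_countable.image _).to_subtype
  have htile : IsTilingComplement volume (unionOfUnitCubes (liftBox B n))
      (latticeInclusion (Fin d) '' T) :=
    isTilingComplement_of_isComplement (isComplement_unionOfUnitCubes hT)
  refine ⟨liftBox B n, ⟨⟨T, isTilingComplement_of_isComplement hT⟩, hA.not_isSpectral_count⟩,
    ⟨⟨_, htile⟩, hA.not_isSpectral_unionOfUnitCubes⟩,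
    ⟨_, htile.congr_ae interior_unionOfUnitCubes_ae_eq.symm⟩, ?_⟩
  rintro ⟨Λ, hΛ⟩
  exact hA.not_isSpectral_unionOfUnitCubes ⟨Λ, hΛ.congr_ae interior_unionOfUnitCubes_ae_eq⟩
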